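/- **Definitions.** All algebras are over $\mathbb{C}$. For a Banach algebra $A$ and $n\ge 0$, let $C^n(A)$ be the Banach space of continuous $(n+1)$-linear functionals on $A$, and let $CC^n(A)\subseteq C^n(A)$ be the closed subspace of cyclic cochains, i.e. of those $f$ with $f(a_0,a_1,\dots,a_n)=(-1)^n f(a_1,\dots,a_n,a_0)$ for all $a_0,\dots,a_n\in A$. The coboundary $$(\delta^n f)(a_0,\dots,a_{n+1})=\sum_{i=0}^{n}(-1)^i f(a_0,\dots,a_ia_{i+1},\dots,a_{n+1})+(-1)^{n+1}f(a_{n+1}a_0,a_1,\dots,a_n)$$ maps $CC^n(A)$ to $CC^{n+1}(A)$ and satisfies $\delta^{n+1}\delta^n=0$. The $n$-dimensional Banach cyclic cohomology group $\mathcal{HC}^n(A)$ is the $n$-th cohomology of the complex $0\to CC^0(A)\to CC^1(A)\to\cdots$, with the quotient seminorm. A continuous homomorphism $\kappa:A\to D$ of Banach algebras induces a linear map $\kappa^*:\mathcal{HC}^n(D)\to\mathcal{HC}^n(A)$ by $f\mapsto f(\kappa(\cdot),\dots,\kappa(\cdot))$. **Proposition 4.4.** Let $m\ge 0$, let $A_1,\dots,A_m$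 be Banach algebras with identity, and let $A=\bigoplus_{i=1}^m A_i$ be their Banach algebra direct sum (with coordinatewise operations, and any complete submultiplicative norm that induces the product topology), with canonical projections $\pi_i:A\to A_i$. Then for every $n\ge 0$ the map $$\bigoplus_{i=1}^m\mathcal{HC}^n(A_i)\longrightarrow\mathcal{HC}^n(A),\qquad (x_1,\dots,x_m)\longmapsto\sum_{i=1}^m\pi_i^*(x_i),$$ is a topological isomorphism of seminormed spaces. In particular $\mathcal{HC}^n(A)=\bigoplus_{i=1}^m\mathcal{HC}^n(A_i)$. -/

import Mathlib

noncomputable section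

namespace BanachCyclic

/-- `C^n(A)`: the Banach space of continuous `(n+1)`-linear functionals on `A`, with the usual norm
of multilinear functionals. -/
def Cochain (A : Type*) [NormedRing A] [NormedAlgebra ℂ A] (n : ℕ) : Type _ :=
  ContinuousMultilinearMap ℂ (fun _ : Fin (n + 1) => A) ℂ

namespace Cochain

variable {A : Type*} [NormedRing A] [NormedAlgebra ℂ A] {n : ℕ}

instance : NormedAddCommGroup (Cochain A n) :=
  inferInstanceAs (NormedAddCommGroup (ContinuousMultilinearMap ℂ (fun _ : Fin (n + 1) => A) ℂ))

instance : NormedSpace ℂ (Cochain A n) :=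
  inferInstanceAs (NormedSpace ℂ (ContinuousMultilinearMap ℂ (fun _ : Fin (n + 1) => A) ℂ))

instance : FunLike (Cochain A n) (Fin (n + 1) → A) ℂ :=
  inferInstanceAs (FunLike (ContinuousMultilinearMap ℂ (fun _ : Fin (n + 1) => A) ℂ) _ _)

@[ext] theorem ext {f g : Cochain A n} (h : ∀ a, f a = g a) : f = g := DFunLike.ext f g h

@[simp] theorem zero_apply (a : Fin (n + 1) → A) : (0 : Cochain A n) a = 0 := rfl

@[simp] theorem add_apply (f g : Cochain A n) (a : Fin (n + 1) → A) :
    (f + g) a = f a + g a := rfl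

@[simp] theorem smul_apply (c : ℂ) (f : Cochain A n) (a : Fin (n + 1) → A) :
    (c • f) a = c * f a := rfl

@[simp] theorem sum_apply {ι : Type*} (s : Finset ι) (f : ι → Cochain A n)
    (a : Fin (n + 1) → A) : (∑ i ∈ s, f i) a = ∑ i ∈ s, f i a :=
  map_sum (⟨⟨fun g => g a, rfl⟩, fun _ _ => rfl⟩ : Cochain A n →+ ℂ) f s

end Cochain

section Coboundary

variable {A : Type*} [NormedRing A] [NormedAlgebra ℂ A]

/-- `(a_0, …, a_{n+1}) ↦ (a_0, …, a_i a_{i+1}, …, a_{n+1})`, for `0 ≤ i ≤ n`. -/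
def merge {n : ℕ} (i : Fin (n + 1)) (a : Fin (n + 2) → A) : Fin (n + 1) → A :=
  fun k => if k < i then a k.castSucc else if k = i then a k.castSucc * a k.succ else a k.succ

/-- `(a_0, …, a_{n+1}) ↦ (a_{n+1} a_0, a_1, …, a_n)`. -/
def mergeLast {n : ℕ} (a : Fin (n + 2) → A) : Fin (n + 1) → A :=
  fun k => if k = 0 then a (Fin.last (n + 1)) * a 0 else a k.castSucc

/-- Replacing one entry of `a` replaces one entry of the merged tuple, in a linear way. -/
theorem merge_update {n : ℕ} (i : Fin (n + 1)) (a : Fin (n + 2) → A) (j : Fin (n + 2)) :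
    ∃ (k : Fin (n + 1)) (l : A →ₗ[ℂ] A), ∀ x : A,
      merge i (Function.update a j x) = Function.update (merge i a) k (l x) := by
  rcases lt_trichotomy j i.castSucc with h | h | h
  · have hj : (j : ℕ) < n + 1 := by have := i.2; simp [Fin.lt_def] at h; omega
    refine ⟨⟨j, hj⟩, LinearMap.id, fun x => funext fun k => ?_⟩
    simp only [merge, Function.update_apply, Fin.ext_iff, Fin.lt_def, Fin.val_castSucc,
      Fin.val_succ, LinearMap.id_apply] at h ⊢
    grind
  · refine ⟨i, LinearMap.mulRight ℂ (a i.succ), fun x => funext fun k => ?_⟩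
    simp only [merge, Function.update_apply, Fin.ext_iff, Fin.lt_def, Fin.val_castSucc,
      Fin.val_succ, LinearMap.mulRight_apply] at h ⊢
    grind
  · by_cases h' : j = i.succ
    · refine ⟨i, LinearMap.mulLeft ℂ (a i.castSucc), fun x => funext fun k => ?_⟩
      simp only [merge, Function.update_apply, Fin.ext_iff, Fin.lt_def, Fin.val_castSucc,
        Fin.val_succ, LinearMap.mulLeft_apply] at h h' ⊢
      grind
    · have hj : (j : ℕ) - 1 < n + 1 := by have := j.2; omega
      refine ⟨⟨j - 1, hj⟩, LinearMap.id, fun x => funext fun k => ?_⟩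
      simp only [merge, Function.update_apply, Fin.ext_iff, Fin.lt_def, Fin.val_castSucc,
        Fin.val_succ, LinearMap.id_apply] at h h' ⊢
      grind

theorem mergeLast_update {n : ℕ} (a : Fin (n + 2) → A) (j : Fin (n + 2)) :
    ∃ (k : Fin (n + 1)) (l : A →ₗ[ℂ] A), ∀ x : A,
      mergeLast (Function.update a j x) = Function.update (mergeLast a) k (l x) := by
  by_cases h0 : j = 0
  · refine ⟨0, LinearMap.mulLeft ℂ (a (Fin.last (n + 1))), fun x => funext fun k => ?_⟩
    simp only [mergeLast, Function.update_apply, Fin.ext_iff, Fin.val_castSucc,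
      Fin.val_last, Fin.val_zero, LinearMap.mulLeft_apply] at h0 ⊢
    grind
  · by_cases h1 : j = Fin.last (n + 1)
    · refine ⟨0, LinearMap.mulRight ℂ (a 0), fun x => funext fun k => ?_⟩
      simp only [mergeLast, Function.update_apply, Fin.ext_iff, Fin.val_castSucc,
        Fin.val_last, Fin.val_zero, LinearMap.mulRight_apply] at h0 h1 ⊢
      grind
    · have hj : (j : ℕ) < n + 1 := by
        have := j.2; simp only [Fin.ext_iff, Fin.val_last] at h1; omega
      refine ⟨⟨j, hj⟩, LinearMap.id, fun x => funext fun k => ?_⟩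
      simp only [mergeLast, Function.update_apply, Fin.ext_iff, Fin.val_castSucc,
        Fin.val_last, Fin.val_zero, LinearMap.id_apply] at h0 h1 ⊢
      grind

theorem continuous_merge {n : ℕ} (i : Fin (n + 1)) :
    Continuous (merge i : (Fin (n + 2) → A) → Fin (n + 1) → A) := by
  refine continuous_pi fun k => ?_
  unfold merge
  split_ifs <;> fun_prop

theorem continuous_mergeLast {n : ℕ} :
    Continuous (mergeLast : (Fin (n + 2) → A) → Fin (n + 1) → A) := by
  refine continuous_pi fun k => ?_
  unfold mergeLast
  split_ifs <;> fun_prop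

/-- Precomposition of a continuous multilinear functional with a continuous map of tuples under
which changing one entry changes one entry linearly. -/
def precomp {n : ℕ} (L : (Fin (n + 2) → A) → Fin (n + 1) → A) (hc : Continuous L)
    (hL : ∀ (a : Fin (n + 2) → A) (j : Fin (n + 2)), ∃ (k : Fin (n + 1)) (l : A →ₗ[ℂ] A),
      ∀ x : A, L (Function.update a j x) = Function.update (L a) k (l x))
    (f : ContinuousMultilinearMap ℂ (fun _ : Fin (n + 1) => A) ℂ) :
    ContinuousMultilinearMap ℂ (fun _ : Fin (n + 2) => A) ℂ where
  toFun a := f (L a)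
  map_update_add' {inst} a j x y := by
    obtain rfl : inst = instDecidableEqFin (n + 2) := Subsingleton.elim _ _
    obtain ⟨k, l, h⟩ := hL a j
    simp only [h, map_add, f.map_update_add]
  map_update_smul' {inst} a j c x := by
    obtain rfl : inst = instDecidableEqFin (n + 2) := Subsingleton.elim _ _
    obtain ⟨k, l, h⟩ := hL a j
    simp only [h, map_smul, f.map_update_smul]
  cont := f.cont.comp hc

/-- The cochain `(a_0, …, a_{n+1}) ↦ f(a_0, …, a_i a_{i+1}, …, a_{n+1})`. -/
def face {n : ℕ} (i : Fin (n + 1)) (f : Cochain A n) : Cochain A (n + 1) :=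
  precomp (merge i) (continuous_merge i) (merge_update i) f

/-- The cochain `(a_0, …, a_{n+1}) ↦ f(a_{n+1} a_0, a_1, …, a_n)`. -/
def faceLast {n : ℕ} (f : Cochain A n) : Cochain A (n + 1) :=
  precomp mergeLast continuous_mergeLast mergeLast_update f

theorem face_apply {n : ℕ} (i : Fin (n + 1)) (f : Cochain A n) (a : Fin (n + 2) → A) :
    face i f a = f (merge i a) := rfl

theorem faceLast_apply {n : ℕ} (f : Cochain A n) (a : Fin (n + 2) → A) :
    faceLast f a = f (mergeLast a) := rfl

variable (A) in
/-- The coboundary `δ^n : C^n(A) → C^{n+1}(A)`,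
`(δ^n f)(a_0, …, a_{n+1}) = ∑_{i=0}^n (-1)^i f(a_0, …, a_i a_{i+1}, …, a_{n+1})
  + (-1)^{n+1} f(a_{n+1} a_0, a_1, …, a_n)`. -/
def delta (n : ℕ) : Cochain A n →ₗ[ℂ] Cochain A (n + 1) where
  toFun f := ∑ i : Fin (n + 1), (-1 : ℂ) ^ (i : ℕ) • face i f + (-1 : ℂ) ^ (n + 1) • faceLast f
  map_add' f g := by
    ext a
    simp only [Cochain.add_apply, Cochain.sum_apply, Cochain.smul_apply, face_apply,
      faceLast_apply, mul_add, Finset.sum_add_distrib]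
    ring
  map_smul' c f := by
    ext a
    simp only [Cochain.add_apply, Cochain.sum_apply, Cochain.smul_apply, face_apply,
      faceLast_apply, mul_add, Finset.mul_sum, RingHom.id_apply]
    simp only [mul_left_comm c]

theorem delta_apply {n : ℕ} (f : Cochain A n) (a : Fin (n + 2) → A) :
    delta A n f a = ∑ i : Fin (n + 1), (-1 : ℂ) ^ (i : ℕ) * f (merge i a)
      + (-1 : ℂ) ^ (n + 1) * f (mergeLast a) := by
  simp [delta, face_apply, faceLast_apply]

variable (A) in
/-- `CC^n(A)`: the cyclic cochains, i.e. those `f` with `t_n f = f`, where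
`(t_n f)(a_0, …, a_n) = (-1)^n f(a_1, …, a_n, a_0)` (the sum `k + 1` is cyclic in `Fin (n + 1)`). -/
def cyclicCochains (n : ℕ) : Submodule ℂ (Cochain A n) where
  carrier := {f | ∀ a : Fin (n + 1) → A, (-1 : ℂ) ^ n * f (fun k => a (k + 1)) = f a}
  zero_mem' a := by simp
  add_mem' {f g} hf hg a := by
    simp only [Cochain.add_apply, mul_add]
    rw [hf a, hg a]
  smul_mem' c f hf a := by
    simp only [Cochain.smul_apply]
    rw [mul_left_comm, hf a]

variable (A) in
/-- The cyclic `n`-cocycles: the kernel of `δ^n` on `CC^n(A)`. -/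
def cyclicCocycles (n : ℕ) : Submodule ℂ (Cochain A n) :=
  cyclicCochains A n ⊓ LinearMap.ker (delta A n)

variable (A) in
/-- The cyclic `n`-coboundaries: `δ^{n-1}(CC^{n-1}(A))` for `n ≥ 1`, and `0` for `n = 0`. -/
def cyclicCoboundaries : (n : ℕ) → Submodule ℂ (Cochain A n)
  | 0 => ⊥
  | n + 1 => (cyclicCochains A n).map (delta A n)

variable (A) in
/-- `HC^n(A)`, the `n`-th Banach cyclic cohomology group: cyclic cocycles modulo cyclic
coboundaries, a seminormed space under the quotient seminorm. -/
abbrev HC (n : ℕ) : Type _ :=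
  cyclicCocycles A n ⧸ (cyclicCoboundaries A n).submoduleOf (cyclicCocycles A n)

end Coboundary

section Functoriality

variable {A D : Type*} [NormedRing A] [NormedAlgebra ℂ A] [NormedRing D] [NormedAlgebra ℂ D]

/-- The map `C^n(A) → C^n(D)` induced by a continuous homomorphism `κ : D → A`:
`(κ^* f)(d_0, …, d_n) = f(κ d_0, …, κ d_n)`. -/
def pullback (κ : D →A[ℂ] A) (n : ℕ) : Cochain A n →ₗ[ℂ] Cochain D n where
  toFun f := ContinuousMultilinearMap.compContinuousLinearMap
    (f : ContinuousMultilinearMap ℂ (fun _ : Fin (n + 1) => A) ℂ)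
    (fun _ : Fin (n + 1) => κ.toContinuousLinearMap)
  map_add' _ _ := rfl
  map_smul' _ _ := rfl

theorem pullback_apply (κ : D →A[ℂ] A) (n : ℕ) (f : Cochain A n) (a : Fin (n + 1) → D) :
    pullback κ n f a = f (fun k => κ (a k)) := rfl

theorem delta_pullback (κ : D →A[ℂ] A) (n : ℕ) (f : Cochain A n) :
    delta D n (pullback κ n f) = pullback κ (n + 1) (delta A n f) := by
  ext a
  have h1 : ∀ i : Fin (n + 1), (fun k => κ (merge i a k)) = merge i (fun k => κ (a k)) := by
    intro i; ext k; simp only [merge]; split_ifs <;> simp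
  have h2 : (fun k => κ (mergeLast a k)) = mergeLast (fun k => κ (a k)) := by
    ext k; simp only [mergeLast]; split_ifs <;> simp
  simp only [delta_apply, pullback_apply, h1, h2]

theorem pullback_mem_cyclicCochains (κ : D →A[ℂ] A) (n : ℕ) {f : Cochain A n}
    (hf : f ∈ cyclicCochains A n) : pullback κ n f ∈ cyclicCochains D n :=
  fun a => hf fun k => κ (a k)

theorem pullback_mem_cyclicCocycles (κ : D →A[ℂ] A) (n : ℕ) {f : Cochain A n}
    (hf : f ∈ cyclicCocycles A n) : pullback κ n f ∈ cyclicCocycles D n := by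
  refine ⟨pullback_mem_cyclicCochains κ n hf.1, ?_⟩
  have h := LinearMap.mem_ker.1 hf.2
  exact LinearMap.mem_ker.2 (by rw [delta_pullback, h, map_zero])

theorem pullback_mem_cyclicCoboundaries (κ : D →A[ℂ] A) (n : ℕ) {f : Cochain A n}
    (hf : f ∈ cyclicCoboundaries A n) : pullback κ n f ∈ cyclicCoboundaries D n := by
  cases n with
  | zero =>
    have h0 : f = 0 := hf
    rw [h0, map_zero]
    exact Submodule.zero_mem _
  | succ n =>
    obtain ⟨g, hg, rfl⟩ := hf
    exact ⟨pullback κ n g, pullback_mem_cyclicCochains κ n hg, delta_pullback κ n g⟩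

/-- The map `HC^n(A) → HC^n(D)` induced by a continuous homomorphism `κ : D → A`. -/
def HCmap (κ : D →A[ℂ] A) (n : ℕ) : HC A n →ₗ[ℂ] HC D n :=
  Submodule.mapQ _ _
    ((pullback κ n).restrict fun _ hf => pullback_mem_cyclicCocycles κ n hf)
    fun _ hf => pullback_mem_cyclicCoboundaries κ n hf

/-- The `i`-th canonical projection of a direct product of Banach algebras. -/
def projection {ι : Type*} (A : ι → Type*) [∀ i, NormedRing (A i)] [∀ i, NormedAlgebra ℂ (A i)]
    (i : ι) : (∀ j, A j) →A[ℂ] A i where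
  toAlgHom := Pi.evalAlgHom ℂ A i
  cont := continuous_apply i

end Functoriality

end BanachCyclic

end

/-! Let e_i be the identity of the i-th factor, seen in `D`: these are central orthogonal
idempotents with sum 1. The inverse map is restriction along the inclusions of the factors. Pulling
back and then restricting is the identity already on cochains, since a mixed term has a zero
argument. In the other order, a cyclic cocycle and its image differ by a cyclic cocycle that
vanishes on every (e_i D)^{n+1}, here called off-diagonal. The heart of the proof is that an
off-diagonal cyclic cocycle is a cyclic coboundary (`mem_cyclicCoboundaries`).

Write t for the cyclic operator, N = 1 + t + ⋯ + t^n, b for the Hochschild coboundary `delta` and b'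
for `barDelta`. Explicit homotopies built from the e_i show that off-diagonal cochains are exact in
positive degrees both for b (`exists_delta_eq`) and for b' (`exists_barDelta_eq`); in degree 0 they
vanish. The b-primitive obtained this way need not be cyclic. Cyclicity is restored by a chase in
the Connes–Tsygan bicomplex, which uses (1 - t⁻¹) b = b' (1 - t⁻¹) (`delta_sub_cycInv_delta`), N b'
= b N (`cycNorm_barDelta`) and ker N = im (1 - t⁻¹) (`exists_sub_cycInv_eq`). The chase lowers the
degree by two, so it is an induction with base cases 0 and 1.

Both maps come from continuous maps of cochains, so the isomorphism is topological although the
quotients need not be Hausdorff. -/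

noncomputable section

namespace BanachCyclic

open Finset

/-! ### Operations on tuples and the identities between them -/

section Tuples
variable {R : Type*} [NormedRing R]

/-- Multiply the entries with indices `i` and `i + 1`. -/
def mergeAt {n : ℕ} (i : ℕ) (a : Fin (n + 2) → R) : Fin (n + 1) → R :=
  fun k => if (k : ℕ) < i then a k.castSucc
    else if (k : ℕ) = i then a k.castSucc * a k.succ else a k.succ

/-- The cyclic rotation `(a_0, …, a_n) ↦ (a_1, …, a_n, a_0)`. -/
def rotate {n : ℕ} (a : Fin (n + 1) → R) : Fin (n + 1) → R := fun k => a (k + 1)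

theorem rotate_apply_of_lt {n : ℕ} (a : Fin (n + 1) → R) (k : Fin (n + 1)) (h : (k : ℕ) < n) :
    rotate a k = a ⟨k + 1, by omega⟩ := by
  refine congrArg a (Fin.ext ?_)
  rw [Fin.val_add_one, if_neg (by simp [Fin.ext_iff]; omega)]

theorem rotate_apply_of_eq {n : ℕ} (a : Fin (n + 1) → R) (k : Fin (n + 1)) (h : (k : ℕ) = n) :
    rotate a k = a 0 := by
  refine congrArg a (Fin.ext ?_)
  rw [Fin.val_add_one, if_pos (by simp [Fin.ext_iff]; omega)]; rfl

/-- With the next two lemmas, this gives the commutation rules between the cyclic operator and the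
faces. -/
theorem mergeAt_rotate {n : ℕ} (i : ℕ) (hi : i < n) (a : Fin (n + 2) → R) :
    mergeAt i (rotate a) = rotate (mergeAt (i + 1) a) := by
  funext k
  rcases Nat.lt_or_ge k n with hk | hk
  · rw [rotate_apply_of_lt _ k hk]
    simp only [mergeAt]
    rw [rotate_apply_of_lt _ k.castSucc (by simp; omega),
      rotate_apply_of_lt _ k.succ (by simp; omega)]
    simp [Fin.succ, Fin.castSucc]
  · rw [rotate_apply_of_eq _ k (by omega)]
    have h1 : ¬ (k : ℕ) < i := by omega
    have h2 : ¬ (k : ℕ) = i := by omega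
    simp only [mergeAt, h1, h2, if_false]
    rw [rotate_apply_of_eq _ k.succ (by simp; omega)]
    simp

theorem mergeAt_last_rotate {n : ℕ} (a : Fin (n + 2) → R) :
    mergeAt n (rotate a) = rotate (mergeLast a) := by
  funext k
  rcases Nat.lt_or_ge k n with hk | hk
  · rw [rotate_apply_of_lt _ k hk]
    simp only [mergeAt, mergeLast, hk, if_true]
    rw [rotate_apply_of_lt _ k.castSucc (by simp; omega)]
    rw [if_neg (fun h => by simpa using congrArg Fin.val h)]
    rfl
  · have hk' : (k : ℕ) = n := by omega
    rw [rotate_apply_of_eq _ k hk']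
    simp only [mergeAt, mergeLast, hk', lt_irrefl, if_false, if_true]
    rw [rotate_apply_of_lt _ k.castSucc (by simp; omega),
      rotate_apply_of_eq _ k.succ (by simp; omega)]
    congr 2
    simp [Fin.ext_iff, hk']

theorem mergeLast_rotate {n : ℕ} (a : Fin (n + 2) → R) :
    mergeLast (rotate a) = mergeAt 0 a := by
  funext k
  by_cases hk : k = 0
  · subst hk
    simp only [mergeAt, mergeLast, if_true]
    rw [rotate_apply_of_eq _ (Fin.last _) (by simp), rotate_apply_of_lt _ 0 (Nat.succ_pos n)]
    rfl
  · have : (k : ℕ) ≠ 0 := fun h => hk (Fin.ext h)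
    simp only [mergeAt, mergeLast, hk, if_false, this, Nat.not_lt_zero]
    rw [rotate_apply_of_lt _ k.castSucc (by simp; omega)]
    rfl

/-- With the next two lemmas, these are the simplicial identities behind b² = 0 and b'² = 0;
associativity enters when the merged positions meet. -/
theorem mergeAt_mergeAt {n : ℕ} (i j : ℕ) (hij : j ≤ i) (a : Fin (n + 3) → R) :
    mergeAt j (mergeAt (i + 1) a) = mergeAt i (mergeAt j a) := by
  funext k
  simp only [mergeAt, Fin.val_castSucc, Fin.val_succ]
  grind

theorem mergeAt_mergeLast {n : ℕ} (i : ℕ) (hi : i ≤ n) (a : Fin (n + 3) → R) :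
    mergeAt i (mergeLast a) = mergeLast (mergeAt i a) := by
  funext k
  simp only [mergeAt, mergeLast, Fin.ext_iff, Fin.val_castSucc, Fin.val_succ, Fin.val_zero,
    Fin.val_last, Fin.succ_last, Fin.castSucc_zero, Fin.succ_castSucc]
  have h : (k : ℕ) = 0 → k = 0 := fun h => Fin.ext h
  grind

theorem mergeLast_mergeLast {n : ℕ} (a : Fin (n + 3) → R) :
    mergeLast (mergeLast a) = mergeLast (mergeAt (n + 1) a) := by
  funext k
  simp only [mergeAt, mergeLast, Fin.ext_iff, Fin.val_castSucc, Fin.val_succ, Fin.val_zero,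
    Fin.val_last, Fin.succ_last, Fin.castSucc_zero, Fin.succ_castSucc]
  grind

/-- `(a_0, …, a_n) ↦ (e, e a_0, a_1, …, a_n)`. -/
def consUnit {n : ℕ} (e : R) (a : Fin (n + 1) → R) : Fin (n + 2) → R :=
  Fin.cons e (Function.update a 0 (e * a 0))

theorem mergeAt_zero_consUnit {n : ℕ} {e : R} (he : e * e = e) (a : Fin (n + 1) → R) :
    mergeAt 0 (consUnit e a) = Function.update a 0 (e * a 0) := by
  funext k
  refine Fin.cases ?_ (fun k => ?_) k
  · simp [mergeAt, consUnit, ← mul_assoc, he]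
  · simp [mergeAt, consUnit]

theorem mergeAt_succ_consUnit {n : ℕ} (i : ℕ) (e : R) (a : Fin (n + 2) → R) :
    mergeAt (i + 1) (consUnit e a) = consUnit e (mergeAt i a) := by
  funext k
  refine Fin.cases ?_ (fun k => ?_) k
  · simp [mergeAt, consUnit]
  · have : (k.succ.castSucc : Fin (n + 3)) = k.castSucc.succ := rfl
    simp only [mergeAt, consUnit, this, Fin.cons_succ, Fin.val_succ, Function.update_apply,
      Nat.add_lt_add_iff_right, Nat.add_right_cancel_iff, Fin.val_zero, Fin.castSucc_zero,
      Fin.ext_iff, Fin.val_castSucc]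
    have h : (k : ℕ) = 0 → k.castSucc = 0 ∧ k.succ = 1 := by
      intro h; constructor <;> ext <;> simp [h]
    grind

/-- `(a_0, …, a_n) ↦ (e a_0, …, e a_k, e, (1 - e) a_{k+1}, a_{k+2}, …, a_n)`. -/
def splitAt {n : ℕ} (e : R) (k : ℕ) (a : Fin (n + 1) → R) : Fin (n + 2) → R :=
  fun j => if (j : ℕ) ≤ k then e * a (Fin.ofNat _ j) else if (j : ℕ) = k + 1 then e
    else if (j : ℕ) = k + 2 then (1 - e) * a (Fin.ofNat _ (j - 1)) else a (Fin.ofNat _ (j - 1))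

/-- The reduction modulo n + 1 in `splitAt` is harmless: all indices are in range when k < n, the
case that enters the homotopy. -/
theorem finOfNat_eq_mk {n j : ℕ} (h : j < n + 1) : Fin.ofNat (n + 1) j = ⟨j, h⟩ := by
  ext; simp [Nat.mod_eq_of_lt h]

/-- `(a_0, …, a_n) ↦ (e a_0, …, e a_k, (1 - e) a_{k+1}, a_{k+2}, …, a_n)`. -/
def cutAt {n : ℕ} (e : R) (k : ℕ) (a : Fin (n + 1) → R) : Fin (n + 1) → R :=
  fun j => if (j : ℕ) ≤ k then e * a j else if (j : ℕ) = k + 1 then (1 - e) * a j else a j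

theorem mergeAt_splitAt_self {n : ℕ} {e : R} (hc : ∀ x, e * x = x * e) (he : e * e = e) (k : ℕ)
    (a : Fin (n + 1) → R) : mergeAt k (splitAt e k a) = cutAt e k a := by
  funext j
  have hj := j.2
  simp only [mergeAt, splitAt, cutAt, Fin.val_castSucc, Fin.val_succ, Nat.add_sub_cancel,
    finOfNat_eq_mk hj]
  have := hc (a j)
  grind

theorem mergeAt_splitAt_succ {n : ℕ} {e : R} (he : e * e = e) (k : ℕ)
    (a : Fin (n + 1) → R) (hk : k < n) :
    mergeAt (k + 1) (splitAt e k a) ⟨k + 1, by omega⟩ = 0 := by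
  simp [mergeAt, splitAt, ← mul_assoc, mul_sub, he]

/-- A merge away from the inserted e commutes with the splitting. To its left the split position
drops by one, and (e x)(e y) = e (x y) by centrality; to its right (`mergeAt_splitAt_gt`) the merge
position shifts instead. -/
theorem mergeAt_splitAt_lt {n : ℕ} {e : R} (hc : ∀ x, e * x = x * e) (he : e * e = e)
    (k j : ℕ) (hj : j ≤ k) (hk : k < n) (a : Fin (n + 2) → R) :
    mergeAt j (splitAt e (k + 1) a) = splitAt e k (mergeAt j a) := by
  funext l
  obtain ⟨l, hl⟩ := l
  have H : ∀ x y : R, e * x * (e * y) = e * (x * y) := fun x y => by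
    rw [hc x, mul_assoc, ← mul_assoc e e, he, ← mul_assoc, ← hc, mul_assoc]
  rcases Nat.lt_or_ge l (n + 1) with h | h
  · rcases Nat.eq_zero_or_pos l with rfl | h0
    · simp only [mergeAt, splitAt, Fin.castSucc_mk, Fin.succ_mk, finOfNat_eq_mk h,
        finOfNat_eq_mk hl,
        Nat.zero_add, finOfNat_eq_mk (show 1 < n + 2 by omega)]
      grind
    · simp only [mergeAt, splitAt, Fin.castSucc_mk, Fin.succ_mk, finOfNat_eq_mk h,
        finOfNat_eq_mk hl,
        Nat.add_sub_cancel, finOfNat_eq_mk (show l + 1 < n + 2 by omega),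
        finOfNat_eq_mk (show l - 1 < n + 1 by omega)]
      grind
  · obtain rfl : l = n + 1 := by omega
    simp only [mergeAt, splitAt, Fin.castSucc_mk, Fin.succ_mk,  finOfNat_eq_mk hl,
        Nat.add_sub_cancel, finOfNat_eq_mk (show n < n + 1 by omega)]
    grind

theorem mergeAt_splitAt_gt {n : ℕ} {e : R} (k j : ℕ) (hj : k < j) (hk : k < n)
    (a : Fin (n + 2) → R) :
    mergeAt (j + 1) (splitAt e k a) = splitAt e k (mergeAt j a) := by
  funext l
  obtain ⟨l, hl⟩ := l
  rcases Nat.lt_or_ge l (n + 1) with h | h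
  · rcases Nat.eq_zero_or_pos l with rfl | h0
    · simp only [mergeAt, splitAt, Fin.castSucc_mk, Fin.succ_mk, finOfNat_eq_mk h,
        finOfNat_eq_mk hl,
        Nat.zero_add, finOfNat_eq_mk (show 1 < n + 2 by omega)]
      grind
    · simp only [mergeAt, splitAt, Fin.castSucc_mk, Fin.succ_mk, finOfNat_eq_mk h,
        finOfNat_eq_mk hl,
        Nat.add_sub_cancel, finOfNat_eq_mk (show l + 1 < n + 2 by omega),
        finOfNat_eq_mk (show l - 1 < n + 1 by omega), finOfNat_eq_mk (show l - 1 < n + 2 by omega)]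
      grind
  · obtain rfl : l = n + 1 := by omega
    simp only [mergeAt, splitAt, Fin.castSucc_mk, Fin.succ_mk, finOfNat_eq_mk hl,
        Nat.add_sub_cancel, finOfNat_eq_mk (show n < n + 1 by omega),
        finOfNat_eq_mk (show n < n + 2 by omega)]
    grind

theorem mergeLast_splitAt {n : ℕ} {e : R} (hc : ∀ x, e * x = x * e) (k : ℕ) (hk : k < n)
    (a : Fin (n + 2) → R) :
    mergeLast (splitAt e k a) = splitAt e k (mergeLast a) := by
  funext l
  obtain ⟨l, hl⟩ := l
  have h0 := finOfNat_eq_mk (n := n) (j := 0) (by omega)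
  have h0' := finOfNat_eq_mk (n := n + 1) (j := 0) (by omega)
  have h0'' : (0 : Fin (n + 2)) = ⟨0, by omega⟩ := rfl
  have H := hc (a ⟨n + 1, by omega⟩)
  simp only [mergeLast, splitAt, Fin.castSucc_mk, Fin.ext_iff, Fin.val_zero, Fin.val_last,
    Nat.add_sub_cancel, finOfNat_eq_mk (show n + 1 < n + 2 by omega)]
  rcases Nat.eq_zero_or_pos l with rfl | hp
  · simp only [h0', h0, h0'', Fin.last]
    grind
  · rcases Nat.lt_or_ge l (n + 1) with h | h
    · simp only [finOfNat_eq_mk h, finOfNat_eq_mk hl, finOfNat_eq_mk (show l - 1 < n + 1 by omega),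
        finOfNat_eq_mk (show l - 1 < n + 2 by omega), Fin.castSucc_mk]
      grind
    · obtain rfl : l = n + 1 := by omega
      simp only [finOfNat_eq_mk hl, Nat.add_sub_cancel, finOfNat_eq_mk (show n < n + 1 by omega),
        finOfNat_eq_mk (show n < n + 2 by omega), Fin.castSucc_mk]
      grind

end Tuples

section MoreTuples
variable {R : Type*} [NormedRing R]

/-- When the split is at the end, the wrap-around product is (1 - e) x · e y = 0. -/
theorem mergeLast_splitAt_self {n : ℕ} {e : R} (hc : ∀ x, e * x = x * e) (he : e * e = e)
    (a : Fin (n + 2) → R) : mergeLast (splitAt e n a) 0 = 0 := by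
  have h : ∀ x y : R, (1 - e) * x * (e * y) = 0 := fun x y => by
    rw [mul_assoc, ← mul_assoc x, ← hc, mul_assoc, ← mul_assoc, sub_mul, one_mul, he, sub_self,
      zero_mul]
  simp [mergeLast, splitAt, h]

theorem consUnit_mul {n : ℕ} {e : R} (he : e * e = e) (a : Fin (n + 1) → R) :
    consUnit e (fun k => e * a k) = fun k => e * consUnit e a k := by
  funext k
  refine Fin.cases ?_ (fun k => ?_) k
  · simp [consUnit, he]
  · simp only [consUnit, Fin.cons_succ, Function.update_apply]
    split_ifs <;> rfl

/-- `(a_0, …, a_n) ↦ (e a_0, …, e a_k, a_{k+1}, …, a_n)`. -/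
def mulPrefix {n : ℕ} (e : R) (k : ℕ) (a : Fin (n + 1) → R) : Fin (n + 1) → R :=
  fun j => if (j : ℕ) ≤ k then e * a j else a j

theorem mulPrefix_zero {n : ℕ} (e : R) (a : Fin (n + 1) → R) :
    mulPrefix e 0 a = Function.update a 0 (e * a 0) := by
  funext j
  simp only [mulPrefix, Function.update_apply, Nat.le_zero, Fin.ext_iff, Fin.val_zero]
  split_ifs with h
  · rw [show j = 0 from Fin.ext h]
  · rfl

theorem mulPrefix_last {n : ℕ} (e : R) (a : Fin (n + 1) → R) :
    mulPrefix e n a = fun j => e * a j := by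
  funext j
  simp [mulPrefix, Nat.lt_succ_iff.1 j.2]

end MoreTuples

/-! ### Pulling cochains back along slotwise linear maps of tuples -/

section Slotwise
variable {A : Type*} [NormedRing A] [NormedAlgebra ℂ A]

/-- A continuous map of tuples under which changing one entry changes one entry linearly. -/
structure Slotwise {p q : ℕ} (L : (Fin p → A) → Fin q → A) : Prop where
  continuous : Continuous L
  update : ∀ (a : Fin p → A) (j : Fin p), ∃ (k : Fin q) (l : A →ₗ[ℂ] A), ∀ x : A,
    L (Function.update a j x) = Function.update (L a) k (l x)

/-- Precomposition of cochains with a slotwise map of tuples. -/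
def slotPullback {p q : ℕ} (L : (Fin (p + 1) → A) → Fin (q + 1) → A) (hL : Slotwise L) :
    Cochain A q →ₗ[ℂ] Cochain A p where
  toFun f :=
    { toFun := fun a => f (L a)
      map_update_add' := by
        intro inst a j x y
        obtain rfl : inst = instDecidableEqFin (p + 1) := Subsingleton.elim _ _
        obtain ⟨k, l, h⟩ := hL.update a j
        simp only [h, map_add]
        exact ContinuousMultilinearMap.map_update_add f _ _ _ _
      map_update_smul' := by
        intro inst a j c x
        obtain rfl : inst = instDecidableEqFin (p + 1) := Subsingleton.elim _ _
        obtain ⟨k, l, h⟩ := hL.update a j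
        simp only [h, map_smul]
        exact ContinuousMultilinearMap.map_update_smul f _ _ _ _
      cont := (ContinuousMultilinearMap.cont f).comp hL.continuous }
  map_add' _ _ := rfl
  map_smul' _ _ := rfl

theorem slotwise_rotate {n : ℕ} : Slotwise (rotate : (Fin (n + 1) → A) → Fin (n + 1) → A) where
  continuous := continuous_pi fun k => continuous_apply _
  update a j := ⟨j - 1, LinearMap.id, fun x => funext fun k => by
    simp only [rotate, Function.update_apply, eq_sub_iff_add_eq, LinearMap.id_apply]⟩

theorem slotwise_consUnit {n : ℕ} (e : A) :
    Slotwise (consUnit e : (Fin (n + 1) → A) → Fin (n + 2) → A) where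
  continuous := by
    refine continuous_pi fun k => ?_
    refine Fin.cases ?_ (fun k => ?_) k
    · simp only [consUnit, Fin.cons_zero]; fun_prop
    · simp only [consUnit, Fin.cons_succ]; fun_prop
  update a j := by
    by_cases hj : j = 0
    · subst hj
      refine ⟨1, LinearMap.mulLeft ℂ e, fun x => funext fun k => ?_⟩
      refine Fin.cases ?_ (fun k => ?_) k
      · simp [consUnit, Function.update_apply]
      · simp only [consUnit, Fin.cons_succ, Function.update_apply, LinearMap.mulLeft_apply]
        by_cases hk : k = 0
        · subst hk; simp
        · simp [hk]
          intro h
          exact absurd (Fin.succ_injective _ h) hk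
    · refine ⟨j.succ, LinearMap.id, fun x => funext fun k => ?_⟩
      refine Fin.cases ?_ (fun k => ?_) k
      · rw [Function.update_of_ne (Fin.succ_ne_zero _).symm]
        simp [consUnit]
      · simp only [consUnit, Fin.cons_succ, Function.update_apply, LinearMap.id_apply,
          Fin.succ_inj, Ne.symm hj, if_false]
        grind

theorem slotwise_splitAt {n : ℕ} (e : A) (k : ℕ) (hk : k < n) :
    Slotwise (splitAt e k : (Fin (n + 1) → A) → Fin (n + 2) → A) where
  continuous := by
    refine continuous_pi fun j => ?_
    unfold splitAt
    split_ifs <;> fun_prop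
  update a p := by
    obtain ⟨p, hp⟩ := p
    -- Entries after position k move one place right to make room for e; the three cases record
    -- whether an entry is multiplied by e, by 1 - e, or left alone.
    have key : ∀ (q : Fin (n + 2)) (l : A →ₗ[ℂ] A),
        ((p ≤ k ∧ (q : ℕ) = p ∧ l = LinearMap.mulLeft ℂ e) ∨
        (p = k + 1 ∧ (q : ℕ) = p + 1 ∧ l = LinearMap.mulLeft ℂ (1 - e)) ∨
        (k + 1 < p ∧ (q : ℕ) = p + 1 ∧ l = LinearMap.id)) → ∀ x : A,
        splitAt e k (Function.update a ⟨p, hp⟩ x) = Function.update (splitAt e k a) q (l x) := by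
      rintro ⟨q, hq⟩ l H x
      have hl : (p ≤ k ∧ q = p ∧ l x = e * x) ∨ (p = k + 1 ∧ q = p + 1 ∧ l x = (1 - e) * x) ∨
          (k + 1 < p ∧ q = p + 1 ∧ l x = x) := by
        rcases H with ⟨h1, h2, rfl⟩ | ⟨h1, h2, rfl⟩ | ⟨h1, h2, rfl⟩ <;> simp_all
      clear H
      generalize l x = y at hl
      funext ⟨j, hj⟩
      simp only [splitAt, Function.update_apply, Fin.ext_iff]
      have h1 : j ≤ n → ((Fin.ofNat (n + 1) j : Fin (n + 1)) : ℕ) = j := fun h => by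
        rw [finOfNat_eq_mk (Nat.lt_succ_of_le h)]
      have h2 : ((Fin.ofNat (n + 1) (j - 1) : Fin (n + 1)) : ℕ) = j - 1 := by
        rw [finOfNat_eq_mk (by omega)]
      rw [h2]
      by_cases hj' : j ≤ n
      · rw [h1 hj']
        grind
      · grind
    rcases lt_trichotomy p (k + 1) with h | h | h
    · exact ⟨⟨p, by omega⟩, _, key _ _ (Or.inl ⟨by omega, rfl, rfl⟩)⟩
    · exact ⟨⟨p + 1, by omega⟩, _, key _ _ (Or.inr (Or.inl ⟨h, rfl, rfl⟩))⟩
    · exact ⟨⟨p + 1, by omega⟩, _, key _ _ (Or.inr (Or.inr ⟨h, rfl, rfl⟩))⟩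

end Slotwise

/-! ### Faces, the cyclic operator and the identities of the cyclic bicomplex -/

section Operators
variable {A : Type*} [NormedRing A] [NormedAlgebra ℂ A]

namespace Cochain
variable {n : ℕ}

theorem map_coord_zero (f : Cochain A n) {a : Fin (n + 1) → A} (i : Fin (n + 1)) (h : a i = 0) :
    f a = 0 :=
  ContinuousMultilinearMap.map_coord_zero f i h

theorem map_update_sub (f : Cochain A n) (a : Fin (n + 1) → A) (i : Fin (n + 1)) (x y : A) :
    f (Function.update a i (x - y)) = f (Function.update a i x) - f (Function.update a i y) :=
  ContinuousMultilinearMap.map_update_sub f a i x y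

theorem map_update_sum {ι : Type*} (f : Cochain A n) (s : Finset ι) (a : Fin (n + 1) → A)
    (i : Fin (n + 1)) (x : ι → A) :
    f (Function.update a i (∑ j ∈ s, x j)) = ∑ j ∈ s, f (Function.update a i (x j)) :=
  MultilinearMap.map_update_sum (ContinuousMultilinearMap.toMultilinearMap f) s i x a

@[simp] theorem sub_apply (f g : Cochain A n) (a : Fin (n + 1) → A) : (f - g) a = f a - g a := rfl

end Cochain

/-- The `i`-th of the `n + 2` maps `C^n(A) → C^{n+1}(A)` in the Hochschild coboundary. -/
def faceAt (n i : ℕ) : Cochain A n →ₗ[ℂ] Cochain A (n + 1) where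
  -- Every index above n yields the wrap-around face; only n + 1 is needed.
  toFun f := if h : i < n + 1 then face ⟨i, h⟩ f else faceLast f
  map_add' f g := by split_ifs <;> rfl
  map_smul' c f := by split_ifs <;> rfl

theorem faceAt_apply {n i : ℕ} (h : i ≤ n) (f : Cochain A n) (a : Fin (n + 2) → A) :
    faceAt n i f a = f (mergeAt i a) := by
  simp only [faceAt, LinearMap.coe_mk, AddHom.coe_mk, dif_pos (Nat.lt_succ_of_le h), face_apply]
  refine congrArg f (funext fun k => ?_)
  simp only [merge, mergeAt, Fin.lt_def, Fin.ext_iff]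

theorem faceAt_last_apply {n : ℕ} (f : Cochain A n) (a : Fin (n + 2) → A) :
    faceAt n (n + 1) f a = f (mergeLast a) := by
  simp only [faceAt, LinearMap.coe_mk, AddHom.coe_mk, dif_neg (lt_irrefl _), faceLast_apply]

/-- The bar coboundary: the Hochschild coboundary without its last term. -/
def barDelta (n : ℕ) : Cochain A n →ₗ[ℂ] Cochain A (n + 1) :=
  ∑ i ∈ range (n + 1), (-1 : ℂ) ^ i • faceAt n i

theorem barDelta_apply {n : ℕ} (f : Cochain A n) :
    barDelta n f = ∑ i ∈ range (n + 1), (-1 : ℂ) ^ i • faceAt n i f := by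
  simp [barDelta, LinearMap.sum_apply]

theorem barDelta_apply_apply {n : ℕ} (f : Cochain A n) (a : Fin (n + 2) → A) :
    barDelta n f a = ∑ i ∈ range (n + 1), (-1 : ℂ) ^ i * f (mergeAt i a) := by
  rw [barDelta_apply, Cochain.sum_apply]
  refine sum_congr rfl fun i hi => ?_
  rw [Cochain.smul_apply, faceAt_apply (Nat.lt_succ_iff.1 (mem_range.1 hi))]

theorem delta_eq_barDelta_add {n : ℕ} (f : Cochain A n) :
    delta A n f = barDelta n f + (-1 : ℂ) ^ (n + 1) • faceAt n (n + 1) f := by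
  ext a
  rw [delta_apply, Cochain.add_apply, Cochain.smul_apply, faceAt_last_apply, barDelta_apply_apply,
    ← Fin.sum_univ_eq_sum_range fun i => (-1 : ℂ) ^ i * f (mergeAt i a)]
  congr 1
  refine sum_congr rfl fun i _ => ?_
  congr 2
  funext k
  simp only [merge, mergeAt, Fin.lt_def, Fin.ext_iff]

theorem delta_eq_sum {n : ℕ} (f : Cochain A n) :
    delta A n f = ∑ i ∈ range (n + 2), (-1 : ℂ) ^ i • faceAt n i f := by
  rw [delta_eq_barDelta_add, barDelta_apply, sum_range_succ _ (n + 1)]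

/-- The cyclic operator `(t f)(a_0, …, a_n) = (-1)^n f(a_1, …, a_n, a_0)`. -/
def cyc (n : ℕ) : Module.End ℂ (Cochain A n) :=
  (-1 : ℂ) ^ n • slotPullback rotate slotwise_rotate

theorem cyc_apply {n : ℕ} (f : Cochain A n) (a : Fin (n + 1) → A) :
    cyc n f a = (-1 : ℂ) ^ n * f (rotate a) := rfl

theorem mem_cyclicCochains_iff {n : ℕ} {f : Cochain A n} :
    f ∈ cyclicCochains A n ↔ cyc n f = f :=
  ⟨fun h => Cochain.ext fun a => h a, fun h a => congrArg (fun g : Cochain A n => g a) h⟩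

theorem cyc_pow_apply {n : ℕ} (j : ℕ) (f : Cochain A n) (a : Fin (n + 1) → A) :
    (cyc n ^ j) f a = ((-1 : ℂ) ^ n) ^ j * f (fun k => a (k + j • 1)) := by
  induction j generalizing a with
  | zero => simp
  | succ j ih =>
    rw [pow_succ', Module.End.mul_apply, cyc_apply, ih, pow_succ', mul_assoc]
    congr 3
    funext k
    simp only [rotate]
    rw [succ_nsmul, add_assoc]

theorem cyc_pow_succ_eq_one (n : ℕ) : cyc (A := A) n ^ (n + 1) = 1 := by
  refine LinearMap.ext fun f => Cochain.ext fun a => ?_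
  rw [cyc_pow_apply, ← pow_mul, (Nat.even_mul_succ_self n).neg_one_pow, one_mul,
    Module.End.one_apply]
  have h : (n + 1) • (1 : Fin (n + 1)) = 0 := by
    simpa using card_nsmul_eq_zero (x := (1 : Fin (n + 1)))
  simp only [h, add_zero]

theorem cyc_faceAt {n i : ℕ} (hi : i ≤ n) (f : Cochain A n) :
    cyc (n + 1) (faceAt n i f) = -faceAt n (i + 1) (cyc n f) := by
  ext a
  change _ = -(faceAt n (i + 1) (cyc n f) a)
  rw [cyc_apply, faceAt_apply hi, pow_succ]
  rcases hi.lt_or_eq with h | rfl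
  · rw [faceAt_apply h, cyc_apply, mergeAt_rotate i h]; ring
  · rw [faceAt_last_apply, cyc_apply, mergeAt_last_rotate]; ring

theorem cyc_faceAt_last {n : ℕ} (f : Cochain A n) :
    cyc (n + 1) (faceAt n (n + 1) f) = (-1 : ℂ) ^ (n + 1) • faceAt n 0 f := by
  ext a
  rw [cyc_apply, faceAt_last_apply, Cochain.smul_apply, faceAt_apply (Nat.zero_le n),
    mergeLast_rotate]

/-- The inverse of the cyclic operator. -/
def cycInv (n : ℕ) : Module.End ℂ (Cochain A n) := cyc n ^ n

theorem cyc_cycInv {n : ℕ} (f : Cochain A n) : cyc n (cycInv n f) = f := by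
  rw [cycInv, ← Module.End.mul_apply, ← pow_succ', cyc_pow_succ_eq_one, Module.End.one_apply]

theorem cycInv_cyc {n : ℕ} (f : Cochain A n) : cycInv n (cyc n f) = f := by
  rw [cycInv, ← Module.End.mul_apply, ← pow_succ, cyc_pow_succ_eq_one, Module.End.one_apply]

theorem cycInv_faceAt_succ {n i : ℕ} (hi : i ≤ n) (f : Cochain A n) :
    cycInv (n + 1) (faceAt n (i + 1) f) = -faceAt n i (cycInv n f) := by
  have h := cyc_faceAt hi (cycInv n f)
  rw [cyc_cycInv] at h
  rw [← neg_eq_iff_eq_neg.2 h, map_neg, cycInv_cyc]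

theorem cycInv_faceAt_zero {n : ℕ} (f : Cochain A n) :
    cycInv (n + 1) (faceAt n 0 f) = (-1 : ℂ) ^ (n + 1) • faceAt n (n + 1) f := by
  have h := congrArg (cycInv (n + 1)) (cyc_faceAt_last f)
  rw [cycInv_cyc, map_smul] at h
  rw [h, smul_smul, ← mul_pow]
  simp

/-- Applying t⁻¹ to b turns the zeroth face into the signed wrap-around term of b and shifts the
other faces down by one, so t⁻¹ b = (b - b') + b' t⁻¹. -/
theorem delta_sub_cycInv_delta {n : ℕ} (f : Cochain A n) :
    delta A n f - cycInv (n + 1) (delta A n f) = barDelta n (f - cycInv n f) := by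
  have h : cycInv (n + 1) (delta A n f) =
      (-1 : ℂ) ^ (n + 1) • faceAt n (n + 1) f + barDelta n (cycInv n f) := by
    rw [delta_eq_sum, map_sum, sum_range_succ', barDelta_apply]
    refine (add_comm _ _).trans ?_
    congr 1
    · simp [cycInv_faceAt_zero]
    · refine sum_congr rfl fun i hi => ?_
      rw [map_smul, cycInv_faceAt_succ (Nat.lt_succ_iff.1 (mem_range.1 hi)), pow_succ]
      simp
  rw [h, delta_eq_barDelta_add, map_sub]
  abel

/-- The norm operator `1 + t + ⋯ + t^n`. -/
def cycNorm (n : ℕ) : Module.End ℂ (Cochain A n) := ∑ i ∈ range (n + 1), cyc n ^ i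

theorem cyc_mul_cycNorm (n : ℕ) : cyc (A := A) n * cycNorm n = cycNorm n := by
  have h := mul_geom_sum (cyc (A := A) n) (n + 1)
  rw [cyc_pow_succ_eq_one, sub_self, sub_mul, one_mul] at h
  exact sub_eq_zero.1 h

theorem cycNorm_mul_cyc (n : ℕ) : cycNorm n * cyc (A := A) n = cycNorm n := by
  have h := geom_sum_mul (cyc (A := A) n) (n + 1)
  rw [cyc_pow_succ_eq_one, sub_self, mul_sub, mul_one] at h
  exact sub_eq_zero.1 h

theorem cycNorm_cycInv {n : ℕ} (f : Cochain A n) : cycNorm n (cycInv n f) = cycNorm n f := by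
  conv_lhs => rw [← cycNorm_mul_cyc, Module.End.mul_apply, cyc_cycInv]

theorem cyc_cycNorm {n : ℕ} (f : Cochain A n) : cyc n (cycNorm n f) = cycNorm n f := by
  rw [← Module.End.mul_apply, cyc_mul_cycNorm]

theorem cycNorm_cyc {n : ℕ} (f : Cochain A n) : cycNorm n (cyc n f) = cycNorm n f := by
  rw [← Module.End.mul_apply, cycNorm_mul_cyc]

theorem cycNorm_eq_of_cyc_eq {n : ℕ} {f : Cochain A n} (h : cyc n f = f) :
    cycNorm n f = ((n : ℂ) + 1) • f := by
  have hp : ∀ i, (cyc n ^ i) f = f := fun i => by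
    induction i with
    | zero => simp
    | succ i ih => rw [pow_succ, Module.End.mul_apply, h, ih]
  simp only [cycNorm, LinearMap.sum_apply, hp, sum_const, card_range]
  rw [← Nat.cast_smul_eq_nsmul ℂ]
  push_cast
  rfl

theorem cyc_eq_iff_cycInv_eq {n : ℕ} {f : Cochain A n} : cycInv n f = f ↔ cyc n f = f :=
  ⟨fun h => by conv_lhs => rw [← h, cyc_cycInv], fun h => by conv_lhs => rw [← h, cycInv_cyc]⟩

/-- Writing d_i for the faces, t d_i = -d_{i+1} t gives (-1)^i d_i t^i = t^i d_0, and N absorbs t^i.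
-/
theorem cycNorm_faceAt {n i : ℕ} (hi : i ≤ n + 1) (f : Cochain A n) :
    (-1 : ℂ) ^ i • cycNorm (n + 1) (faceAt n i ((cyc n ^ i) f)) =
      cycNorm (n + 1) (faceAt n 0 f) := by
  induction i with
  | zero => simp
  | succ i ih =>
    rw [← ih (by omega), pow_succ' (cyc n), Module.End.mul_apply,
      ← neg_eq_iff_eq_neg.2 (cyc_faceAt (show i ≤ n by omega) ((cyc n ^ i) f)), map_neg,
      cycNorm_cyc,
      pow_succ]
    simp

theorem faceAt_cycNorm {n i : ℕ} (hi : i ≤ n + 1) (f : Cochain A n) :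
    (-1 : ℂ) ^ i • faceAt n i (cycNorm n f) = (cyc (n + 1) ^ i) (faceAt n 0 (cycNorm n f)) := by
  induction i with
  | zero => simp
  | succ i ih =>
    rw [pow_succ' (cyc (n + 1)), Module.End.mul_apply, ← ih (by omega), map_smul,
      cyc_faceAt (show i ≤ n by omega), cyc_cycNorm, pow_succ]
    simp

theorem delta_cycNorm {n : ℕ} (f : Cochain A n) :
    delta A n (cycNorm n f) = cycNorm (n + 1) (faceAt n 0 (cycNorm n f)) := by
  rw [delta_eq_sum]
  exact (sum_congr rfl fun i hi => faceAt_cycNorm (Nat.lt_succ_iff.1 (mem_range.1 hi)) f).trans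
    (LinearMap.sum_apply _ _ _).symm

theorem cyc_pow_cycInv_pow {n : ℕ} (i : ℕ) (f : Cochain A n) :
    (cyc n ^ i) ((cycInv n ^ i) f) = f := by
  have h : cyc n * cycInv n = (1 : Module.End ℂ (Cochain A n)) := LinearMap.ext cyc_cycInv
  have hc : Commute (cyc (A := A) n) (cycInv n) := (Commute.refl _).pow_right n
  rw [← Module.End.mul_apply, ← hc.mul_pow, h, one_pow, Module.End.one_apply]

theorem sum_cycInv_pow {n : ℕ} : ∑ i ∈ range (n + 1), cycInv (A := A) n ^ i = cycNorm n := by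
  have h : ∀ i ∈ range (n + 1), cycInv (A := A) n ^ i = cyc n * cyc n ^ (n + 1 - 1 - i) := by
    intro i hi
    refine LinearMap.ext fun f => ?_
    have hi' : n + 1 - 1 - i + 1 + i = n + 1 := by have := mem_range.1 hi; omega
    conv_rhs => rw [← cyc_pow_cycInv_pow i f]
    rw [← pow_succ', ← Module.End.mul_apply, ← pow_add, hi', cyc_pow_succ_eq_one,
      Module.End.one_apply]
  rw [sum_congr rfl h, ← mul_sum, sum_range_reflect (fun i => cyc (A := A) n ^ i) (n + 1)]
  exact cyc_mul_cycNorm n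

/-- Both sides equal N d_0 N: on the left, N (-1)^i d_i = N d_0 t^{-i}, and the powers t^{-i} sum to
N; on the right this is `delta_cycNorm`. -/
theorem cycNorm_barDelta {n : ℕ} (f : Cochain A n) :
    cycNorm (n + 1) (barDelta n f) = delta A n (cycNorm n f) := by
  have h : ∀ i ∈ range (n + 1), (-1 : ℂ) ^ i • cycNorm (n + 1) (faceAt n i f) =
      cycNorm (n + 1) (faceAt n 0 ((cycInv n ^ i) f)) := by
    intro i hi
    rw [← cycNorm_faceAt (show i ≤ n + 1 by have := mem_range.1 hi; omega) ((cycInv n ^ i) f),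
      cyc_pow_cycInv_pow]
  rw [delta_cycNorm, barDelta_apply, map_sum]
  simp only [map_smul]
  rw [sum_congr rfl h, ← map_sum, ← map_sum, ← LinearMap.sum_apply, sum_cycInv_pow]

theorem exists_sub_cycInv_eq {n : ℕ} {f : Cochain A n} (hf : cycNorm n f = 0)
    {O : Submodule ℂ (Cochain A n)} (hO : ∀ g ∈ O, cyc n g ∈ O) (hfO : f ∈ O) :
    ∃ u ∈ O, u - cycInv n u = f := by
  have hpow : ∀ i, (cyc n ^ i) f ∈ O := fun i => by
    induction i with
    | zero => simpa
    | succ i ih => rw [pow_succ', Module.End.mul_apply]; exact hO _ ih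
  have hn : ((n : ℂ) + 1) ≠ 0 := Nat.cast_add_one_ne_zero n
  -- Summation by parts for S = ∑ i t^i f. At m = n + 1, with N f = 0 and t^{n+1} = 1, it reads t S
  -- - S = (n + 1) f, so u = t S / (n + 1) works.
  have hsum : ∀ m : ℕ, cyc n (∑ i ∈ range m, (i : ℂ) • (cyc n ^ i) f) -
      ∑ i ∈ range m, (i : ℂ) • (cyc n ^ i) f =
        (m : ℂ) • (cyc n ^ m) f - cyc n (∑ i ∈ range m, (cyc n ^ i) f) := fun m => by
    induction m with
    | zero => simp
    | succ m ih =>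
      rw [sum_range_succ, sum_range_succ, map_add, map_add, add_sub_add_comm, ih, map_smul,
        ← Module.End.mul_apply, ← pow_succ']
      push_cast
      module
  have h := hsum (n + 1)
  rw [← LinearMap.sum_apply, ← cycNorm, hf, map_zero, sub_zero, cyc_pow_succ_eq_one,
    Module.End.one_apply] at h
  refine ⟨((n : ℂ) + 1)⁻¹ • cyc n (∑ i ∈ range (n + 1), (i : ℂ) • (cyc n ^ i) f),
    O.smul_mem _ (hO _ (O.sum_mem fun i _ => O.smul_mem _ (hpow i))), ?_⟩
  rw [map_smul, cycInv_cyc, ← smul_sub, h, smul_smul, Nat.cast_add_one, inv_mul_cancel₀ hn,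
    one_smul]

/-- Index bookkeeping for `delta_splitSum_add`: the two terms adjacent to the inserted e are split
off, and the rest is reindexed to the range of the double sum for the opposite composite, where it
cancels. -/
theorem sum_range_sum_eq_diagonal (m : ℕ) (G : ℕ → ℕ → ℂ) :
    ∑ k ∈ range (m + 1), ∑ j ∈ range (m + 2), G k j =
      ∑ k ∈ range (m + 1), (G k k + G k (k + 1)) +
        ∑ k ∈ range m, ∑ j ∈ range (m + 1), if j ≤ k then G (k + 1) j else G k (j + 1) := by
  have h1 : ∀ k ∈ range (m + 1), ∑ j ∈ range (m + 2), G k j = (G k k + G k (k + 1)) +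
      (∑ j ∈ range (m + 1), (if j < k then G k j else 0) +
        ∑ j ∈ range (m + 1), if k < j then G k (j + 1) else 0) := by
    intro k hk
    have hk := mem_range.1 hk
    have h2 : ∀ j, G k j = (if j < k then G k j else 0) + (if j = k then G k j else 0) +
        (if j = k + 1 then G k j else 0) + (if k + 1 < j then G k j else 0) := by
      intro j
      rcases lt_trichotomy j k with h | h | h
      · simp [h, h.ne, show j ≠ k + 1 by omega, show ¬ k + 1 < j by omega]
      · simp [h]
      · rcases (Nat.succ_le_of_lt h).eq_or_lt with h' | h'
        · simp [← h']
        · simp [h.ne', show ¬ j < k by omega, show j ≠ k + 1 by omega, show k + 1 < j by omega]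
    rw [sum_congr rfl fun j _ => h2 j]
    simp only [sum_add_distrib, sum_ite_eq', mem_range]
    rw [sum_range_succ _ (m + 1), sum_range_succ' (fun j => if k + 1 < j then G k j else 0)]
    simp [show k < m + 2 by omega, show k < m + 1 by omega, show ¬ m + 1 < k by omega]
    ring
  rw [sum_congr rfl h1, sum_add_distrib]
  congr 1
  rw [sum_add_distrib, sum_range_succ' (fun k =>
    ∑ j ∈ range (m + 1), if j < k then G k j else 0), sum_range_succ (fun k =>
    ∑ j ∈ range (m + 1), if k < j then G k (j + 1) else 0)]
  have h3 : ∑ j ∈ range (m + 1), (if m < j then G m (j + 1) else 0) = 0 :=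
    sum_eq_zero fun j hj => if_neg (by have := mem_range.1 hj; omega)
  rw [h3]
  simp only [Nat.not_lt_zero, if_false, sum_const_zero, add_zero, ← sum_add_distrib]
  refine sum_congr rfl fun k _ => sum_congr rfl fun j _ => ?_
  by_cases h : j ≤ k
  · simp [h, Nat.lt_succ_of_le h]
  · simp [h, not_le.1 h, show ¬ j < k + 1 by omega]

theorem sum_range_sum_eq_zero (m : ℕ) (G : ℕ → ℕ → ℂ)
    (hG : ∀ j < m, ∀ i ≤ j, G (j + 1) i = -G i j) :
    ∑ j ∈ range (m + 1), ∑ i ∈ range m, G j i = 0 := by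
  have h1 : ∀ j i, G j i = (if i < j then G j i else 0) + if j ≤ i then G j i else 0 := by
    intro j i
    rcases Nat.lt_or_ge i j with h | h
    · simp [h, not_le.2 h]
    · simp [h, not_lt.2 h]
  simp_rw [fun j => sum_congr rfl fun i (_ : i ∈ range m) => h1 j i, sum_add_distrib]
  rw [sum_range_succ' (fun j => ∑ i ∈ range m, if i < j then G j i else 0),
    sum_range_succ (fun j => ∑ i ∈ range m, if j ≤ i then G j i else 0)]
  have h2 : ∑ i ∈ range m, (if m ≤ i then G m i else 0) = 0 :=
    sum_eq_zero fun i hi => if_neg (not_le.2 (mem_range.1 hi))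
  rw [h2, sum_comm (f := fun j i => if j ≤ i then G j i else 0)]
  simp only [Nat.not_lt_zero, if_false, sum_const_zero, add_zero, ← sum_add_distrib]
  refine sum_eq_zero fun j hj => sum_eq_zero fun i _ => ?_
  by_cases h : i ≤ j
  · simp [h, Nat.lt_succ_of_le h, hG j (mem_range.1 hj) i h]
  · simp [h, show ¬ i < j + 1 by omega]

theorem barDelta_barDelta {n : ℕ} (f : Cochain A n) : barDelta (n + 1) (barDelta n f) = 0 := by
  ext a
  rw [barDelta_apply_apply, Cochain.zero_apply]
  simp_rw [barDelta_apply_apply, mul_sum]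
  refine sum_range_sum_eq_zero (n + 1)
    (fun j i => (-1 : ℂ) ^ j * ((-1 : ℂ) ^ i * f (mergeAt i (mergeAt j a)))) fun j _ i hi => ?_
  simp only [mergeAt_mergeAt j i hi]
  ring

theorem faceAt_faceAt {n i j : ℕ} (hi : i ≤ j) (hj : j ≤ n + 1) (f : Cochain A n) :
    faceAt (n + 1) (j + 1) (faceAt n i f) = faceAt (n + 1) i (faceAt n j f) := by
  ext a
  rcases hj.lt_or_eq with h | rfl
  · rw [faceAt_apply (by omega), faceAt_apply (by omega), faceAt_apply (by omega),
      faceAt_apply (by omega), mergeAt_mergeAt j i hi]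
  · rw [faceAt_last_apply, faceAt_apply hi, faceAt_last_apply]
    rcases hi.lt_or_eq with h | rfl
    · rw [faceAt_apply (by omega), mergeAt_mergeLast i (by omega)]
    · rw [faceAt_last_apply, mergeLast_mergeLast]

theorem delta_delta {n : ℕ} (f : Cochain A n) : delta A (n + 1) (delta A n f) = 0 := by
  ext a
  simp_rw [delta_eq_sum, map_sum, Cochain.sum_apply, Cochain.smul_apply, map_smul,
    Cochain.sum_apply, Cochain.smul_apply, mul_sum, Cochain.zero_apply]
  refine sum_range_sum_eq_zero (n + 2) (fun j i =>
    (-1 : ℂ) ^ j * ((-1 : ℂ) ^ i * faceAt (n + 1) j (faceAt n i f) a)) fun j hj i hi => ?_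
  simp only [faceAt_faceAt hi (Nat.lt_succ_iff.1 hj)]
  ring

end Operators

/-! ### The two contracting homotopies attached to a central idempotent -/

section Homotopy
variable {A : Type*} [NormedRing A] [NormedAlgebra ℂ A]

/-- A finite family of central orthogonal idempotents with sum `1`. -/
structure IsCentralDecomposition {ι : Type*} [Fintype ι] (e : ι → A) : Prop where
  central : ∀ i x, e i * x = x * e i
  idem : ∀ i, e i * e i = e i
  orthogonal : ∀ i j, i ≠ j → e i * e j = 0
  sum_eq_one : ∑ i, e i = 1

/-- `(s_e f)(a_0, …, a_n) = f(e, e a_0, a_1, …, a_n)`. -/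
def insertFirst (e : A) (n : ℕ) : Cochain A (n + 1) →ₗ[ℂ] Cochain A n :=
  slotPullback (consUnit e) (slotwise_consUnit e)

theorem insertFirst_apply (e : A) {n : ℕ} (f : Cochain A (n + 1)) (a : Fin (n + 1) → A) :
    insertFirst e n f a = f (consUnit e a) := rfl

theorem barDelta_insertFirst_add {e : A} (he : e * e = e) {n : ℕ} (f : Cochain A (n + 1))
    (a : Fin (n + 2) → A) :
    barDelta n (insertFirst e n f) a + insertFirst e (n + 1) (barDelta (n + 1) f) a =
      f (Function.update a 0 (e * a 0)) := by
  rw [insertFirst_apply, barDelta_apply_apply, barDelta_apply_apply, sum_range_succ' _ (n + 1),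
    mergeAt_zero_consUnit he, ← add_assoc, ← sum_add_distrib]
  simp only [insertFirst_apply, mergeAt_succ_consUnit]
  rw [sum_eq_zero fun i _ => by ring]
  simp

/-- The operator `f ↦ ∑_k (-1)^k f(e a_0, …, e a_k, e, (1 - e) a_{k+1}, a_{k+2}, …, a_n)`. -/
def splitSum (e : A) (n : ℕ) : Cochain A (n + 1) →ₗ[ℂ] Cochain A n :=
  ∑ k : Fin n, (-1 : ℂ) ^ (k : ℕ) • slotPullback (splitAt e k) (slotwise_splitAt e k k.2)

theorem splitSum_apply (e : A) {n : ℕ} (f : Cochain A (n + 1)) (a : Fin (n + 1) → A) :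
    splitSum e n f a = ∑ k ∈ range n, (-1 : ℂ) ^ k * f (splitAt e k a) := by
  rw [splitSum, LinearMap.sum_apply, Cochain.sum_apply,
    ← Fin.sum_univ_eq_sum_range fun k => (-1 : ℂ) ^ k * f (splitAt e k a)]
  rfl

theorem delta_apply_eq_sum {n : ℕ} (f : Cochain A n) (a : Fin (n + 2) → A) :
    delta A n f a = ∑ i ∈ range (n + 1), (-1 : ℂ) ^ i * f (mergeAt i a) +
      (-1 : ℂ) ^ (n + 1) * f (mergeLast a) := by
  rw [delta_eq_barDelta_add, Cochain.add_apply, Cochain.smul_apply, faceAt_last_apply,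
    barDelta_apply_apply]

/-- Linearity in slot k + 1; it makes the diagonal terms of the homotopy telescope. -/
theorem apply_cutAt (e : A) {n k : ℕ} (hk : k < n) (f : Cochain A n) (a : Fin (n + 1) → A) :
    f (cutAt e k a) = f (mulPrefix e k a) - f (mulPrefix e (k + 1) a) := by
  have hk' : k + 1 < n + 1 := by omega
  have h0 : cutAt e k a = Function.update (mulPrefix e k a) ⟨k + 1, hk'⟩
      (a ⟨k + 1, hk'⟩ - e * a ⟨k + 1, hk'⟩) := by
    funext j
    simp only [cutAt, mulPrefix, Function.update_apply, Fin.ext_iff]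
    split_ifs with h1 h2
    · omega
    · rfl
    · obtain rfl : j = ⟨k + 1, hk'⟩ := Fin.ext ‹_›
      rw [sub_mul, one_mul]
    · rfl
  have h1 : Function.update (mulPrefix e k a) ⟨k + 1, hk'⟩ (a ⟨k + 1, hk'⟩) = mulPrefix e k a := by
    refine Function.update_eq_self_iff.2 ?_
    simp [mulPrefix]
  have h2 : Function.update (mulPrefix e k a) ⟨k + 1, hk'⟩ (e * a ⟨k + 1, hk'⟩) =
      mulPrefix e (k + 1) a := by
    funext j
    simp only [mulPrefix, Function.update_apply, Fin.ext_iff]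
    split_ifs with h1 h2
    · obtain rfl : j = ⟨k + 1, hk'⟩ := Fin.ext ‹_›
      rfl
    all_goals first | rfl | omega
  rw [h0, Cochain.map_update_sub, h1, h2]

/-- Of the two products involving the inserted e, one vanishes since e (1 - e) = 0 and the other
telescopes in k from `mulPrefix e 0` to `mulPrefix e n` at the level of `apply_cutAt`, ending when
every entry carries e. All remaining terms cancel between the two composites. -/
theorem delta_splitSum_add {e : A} (hc : ∀ x, e * x = x * e) (he : e * e = e) {n : ℕ}
    (f : Cochain A (n + 1)) (a : Fin (n + 2) → A) :
    delta A n (splitSum e n f) a + splitSum e (n + 1) (delta A (n + 1) f) a =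
      f (Function.update a 0 (e * a 0)) - f (fun k => e * a k) := by
  have hlast : ∑ k ∈ range (n + 1), (-1 : ℂ) ^ k * ((-1 : ℂ) ^ (n + 1 + 1) *
      f (mergeLast (splitAt e k a))) =
      -((-1 : ℂ) ^ (n + 1) * ∑ k ∈ range n, (-1 : ℂ) ^ k * f (splitAt e k (mergeLast a))) := by
    rw [sum_range_succ, f.map_coord_zero 0 (mergeLast_splitAt_self hc he a), mul_sum,
      ← sum_neg_distrib, mul_zero, mul_zero, add_zero]
    refine sum_congr rfl fun k hk => ?_
    rw [mergeLast_splitAt hc k (mem_range.1 hk)]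
    ring
  have hdiag : ∀ k ∈ range (n + 1),
      (-1 : ℂ) ^ k * ((-1 : ℂ) ^ k * f (mergeAt k (splitAt e k a))) +
        (-1 : ℂ) ^ k * ((-1 : ℂ) ^ (k + 1) * f (mergeAt (k + 1) (splitAt e k a))) =
      f (mulPrefix e k a) - f (mulPrefix e (k + 1) a) := by
    intro k hk
    have hk := mem_range.1 hk
    rw [f.map_coord_zero _ (mergeAt_splitAt_succ he k a hk), mergeAt_splitAt_self hc he,
      apply_cutAt e hk, ← mul_assoc, ← mul_pow]
    simp
  rw [splitSum_apply, delta_apply_eq_sum]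
  simp only [delta_apply_eq_sum, splitSum_apply, mul_add, sum_add_distrib]
  rw [hlast]
  simp only [mul_sum (s := range (n + 2))]
  rw [sum_range_sum_eq_diagonal n fun k j =>
    (-1 : ℂ) ^ k * ((-1 : ℂ) ^ j * f (mergeAt j (splitAt e k a))), sum_congr rfl hdiag,
    sum_range_sub' (fun k => f (mulPrefix e k a)), mulPrefix_zero, mulPrefix_last]
  have hoff : ∑ k ∈ range n, ∑ j ∈ range (n + 1), (if j ≤ k then
      (-1 : ℂ) ^ (k + 1) * ((-1 : ℂ) ^ j * f (mergeAt j (splitAt e (k + 1) a))) else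
      (-1 : ℂ) ^ k * ((-1 : ℂ) ^ (j + 1) * f (mergeAt (j + 1) (splitAt e k a)))) =
      -∑ j ∈ range (n + 1), (-1 : ℂ) ^ j * ∑ k ∈ range n, (-1 : ℂ) ^ k *
        f (splitAt e k (mergeAt j a)) := by
    simp only [mul_sum]
    rw [sum_comm (s := range (n + 1)), ← sum_neg_distrib]
    refine sum_congr rfl fun k hk => ?_
    rw [← sum_neg_distrib]
    refine sum_congr rfl fun j _ => ?_
    split_ifs with h
    · rw [mergeAt_splitAt_lt hc he k j h (mem_range.1 hk)]; ring
    · rw [mergeAt_splitAt_gt k j (not_le.1 h) (mem_range.1 hk)]; ring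
  rw [hoff]
  ring

end Homotopy

/-! ### Off-diagonal cyclic cocycles are cyclic coboundaries -/

section OffDiagonal
variable {A : Type*} [NormedRing A] [NormedAlgebra ℂ A] {ι : Type*}

/-- The cochains that vanish on `(e_i A)^{n+1}` for every `i`. -/
def offDiagonal (e : ι → A) (n : ℕ) : Submodule ℂ (Cochain A n) where
  carrier := {f | ∀ (i : ι) (a : Fin (n + 1) → A), f (fun k => e i * a k) = 0}
  zero_mem' _ _ := rfl
  add_mem' hf hg i a := by rw [Cochain.add_apply, hf, hg, add_zero]
  smul_mem' c f hf i a := by rw [Cochain.smul_apply, hf, mul_zero]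

variable [Fintype ι] {e : ι → A}

namespace IsCentralDecomposition

theorem _root_.BanachCyclic.cyc_mem_offDiagonal {n : ℕ} {f : Cochain A n}
    (hf : f ∈ offDiagonal e n) : cyc n f ∈ offDiagonal e n := by
  intro i a
  rw [cyc_apply, show rotate (fun k => e i * a k) = fun k => e i * rotate a k from rfl, hf,
    mul_zero]

theorem _root_.BanachCyclic.cyc_pow_mem_offDiagonal {n : ℕ} {f : Cochain A n}
    (hf : f ∈ offDiagonal e n) (j : ℕ) : (cyc n ^ j) f ∈ offDiagonal e n := by
  induction j with
  | zero => simpa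
  | succ j ih => rw [pow_succ', Module.End.mul_apply]; exact cyc_mem_offDiagonal ih

theorem _root_.BanachCyclic.cycNorm_mem_offDiagonal {n : ℕ} {f : Cochain A n}
    (hf : f ∈ offDiagonal e n) : cycNorm n f ∈ offDiagonal e n := by
  rw [cycNorm, LinearMap.sum_apply]
  exact Submodule.sum_mem _ fun j _ => cyc_pow_mem_offDiagonal hf j

theorem _root_.BanachCyclic.cycInv_mem_offDiagonal {n : ℕ} {f : Cochain A n}
    (hf : f ∈ offDiagonal e n) : cycInv n f ∈ offDiagonal e n :=
  cyc_pow_mem_offDiagonal hf n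

/-- This is why e_i is inserted and the results are summed over i, rather than inserting 1: each
summand stays off-diagonal. -/
theorem insertFirst_mem (he : IsCentralDecomposition e) {n : ℕ} {f : Cochain A (n + 1)}
    (hf : f ∈ offDiagonal e (n + 1)) (i : ι) : insertFirst (e i) n f ∈ offDiagonal e n := by
  intro j a
  rw [insertFirst_apply]
  by_cases h : i = j
  · subst h
    rw [consUnit_mul (he.idem i), hf]
  · refine f.map_coord_zero (Fin.succ 0) ?_
    simp [consUnit, ← mul_assoc, he.orthogonal i j h]

theorem splitSum_mem (he : IsCentralDecomposition e) {n : ℕ} (f : Cochain A (n + 1)) (i : ι) :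
    splitSum (e i) n f ∈ offDiagonal e n := by
  intro j a
  rw [splitSum_apply]
  refine sum_eq_zero fun k hk => ?_
  have hk := mem_range.1 hk
  by_cases h : i = j
  · subst h
    rw [f.map_coord_zero ⟨k + 2, by omega⟩, mul_zero]
    simp [splitAt, ← mul_assoc, sub_mul, he.idem]
  · rw [f.map_coord_zero 0, mul_zero]
    simp [splitAt, ← mul_assoc, he.orthogonal i j h]

theorem sum_update_zero (he : IsCentralDecomposition e) {n : ℕ} (f : Cochain A n)
    (a : Fin (n + 1) → A) : ∑ i, f (Function.update a 0 (e i * a 0)) = f a := by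
  rw [← Cochain.map_update_sum, ← sum_mul, he.sum_eq_one, one_mul, Function.update_eq_self]

theorem exists_barDelta_eq (he : IsCentralDecomposition e) {n : ℕ} {f : Cochain A (n + 1)}
    (hf : f ∈ offDiagonal e (n + 1)) (h : barDelta (n + 1) f = 0) :
    ∃ g ∈ offDiagonal e n, barDelta n g = f := by
  refine ⟨∑ i, insertFirst (e i) n f, Submodule.sum_mem _ fun i _ => he.insertFirst_mem hf i, ?_⟩
  ext a
  rw [map_sum, Cochain.sum_apply, ← he.sum_update_zero f a]
  refine sum_congr rfl fun i _ => ?_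
  rw [← barDelta_insertFirst_add (he.idem i) f a, h, map_zero, Cochain.zero_apply, add_zero]

theorem exists_delta_eq (he : IsCentralDecomposition e) {n : ℕ} {f : Cochain A (n + 1)}
    (hf : f ∈ offDiagonal e (n + 1)) (h : delta A (n + 1) f = 0) :
    ∃ g ∈ offDiagonal e n, delta A n g = f := by
  refine ⟨∑ i, splitSum (e i) n f, Submodule.sum_mem _ fun i _ => he.splitSum_mem f i, ?_⟩
  ext a
  rw [map_sum, Cochain.sum_apply, ← he.sum_update_zero f a]
  refine sum_congr rfl fun i _ => ?_
  have H := delta_splitSum_add (he.central i) (he.idem i) f a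
  rwa [h, map_zero, Cochain.zero_apply, add_zero, hf, sub_zero] at H

theorem offDiagonal_zero (he : IsCentralDecomposition e) {f : Cochain A 0}
    (hf : f ∈ offDiagonal e 0) : f = 0 := by
  ext a
  rw [← he.sum_update_zero f a, Cochain.zero_apply]
  refine sum_eq_zero fun i _ => ?_
  rw [← hf i a]
  refine congrArg f (funext fun k => ?_)
  obtain rfl : k = 0 := Fin.ext (by omega)
  rw [Function.update_self]

/-- A cyclic cocycle that vanishes on `(e_i A)^{n+1}` for every `i` is a cyclic coboundary. -/
theorem mem_cyclicCoboundaries (he : IsCentralDecomposition e) : ∀ (n : ℕ) {f : Cochain A n},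
    f ∈ cyclicCocycles A n → f ∈ offDiagonal e n → f ∈ cyclicCoboundaries A n
  | 0, f, _, hO => he.offDiagonal_zero hO
  | 1, f, hf, hO => by
    obtain ⟨g, hg, rfl⟩ := he.exists_delta_eq hO hf.2
    rw [he.offDiagonal_zero hg, map_zero]
    exact Submodule.zero_mem _
  | n + 2, f, hf, hO => by
    obtain ⟨g, hg, rfl⟩ := he.exists_delta_eq hO hf.2
    have hcyc := cyc_eq_iff_cycInv_eq.2 (mem_cyclicCochains_iff.1 hf.1)
    -- The failure of g to be cyclic, (1 - t⁻¹) g, is a b'-cocycle because b g is cyclic.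
    have hw : barDelta (n + 1) (g - cycInv (n + 1) g) = 0 := by
      rw [← delta_sub_cycInv_delta, hcyc, sub_self]
    obtain ⟨v, hv, hvw⟩ := he.exists_barDelta_eq
      (Submodule.sub_mem _ hg (cycInv_mem_offDiagonal hg)) hw
    -- Induction two degrees down: N v is cyclic and off-diagonal, and b N v = N b' v = N (1 - t⁻¹)
    -- g = 0.
    have hN : cycNorm n v ∈ cyclicCoboundaries A n := by
      refine he.mem_cyclicCoboundaries n ⟨mem_cyclicCochains_iff.2 (cyc_cycNorm v), ?_⟩
        (cycNorm_mem_offDiagonal hv)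
      refine LinearMap.mem_ker.2 ?_
      rw [← cycNorm_barDelta, hvw, map_sub, cycNorm_cycInv, sub_self]
    -- A correction of v that kills its norm without changing b' v. With N v = b c and c cyclic of
    -- degree k, take x = b' c / (k + 1), since N c = (k + 1) c.
    obtain ⟨x, hx, hx'⟩ : ∃ x : Cochain A n, cycNorm n x = cycNorm n v ∧ barDelta n x = 0 := by
      cases n with
      | zero => exact ⟨0, by rw [he.offDiagonal_zero hv], map_zero _⟩
      | succ k =>
        obtain ⟨c, hc, hcv⟩ := hN
        refine ⟨barDelta k (((k : ℂ) + 1)⁻¹ • c), ?_, barDelta_barDelta _⟩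
        rw [cycNorm_barDelta, map_smul, cycNorm_eq_of_cyc_eq (mem_cyclicCochains_iff.1 hc),
          smul_smul, inv_mul_cancel₀ (Nat.cast_add_one_ne_zero k), one_smul, hcv]
    obtain ⟨u, -, hu⟩ := exists_sub_cycInv_eq (f := v - x) (O := ⊤)
      (by rw [map_sub, hx, sub_self]) (fun _ _ => trivial) trivial
    -- The corrected primitive is cyclic: (1 - t⁻¹) b u = b' (v - x) = b' v = (1 - t⁻¹) g.
    refine ⟨g - delta A n u, mem_cyclicCochains_iff.2 (cyc_eq_iff_cycInv_eq.1 ?_), ?_⟩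
    · have h := delta_sub_cycInv_delta u
      rw [hu, map_sub, hx', sub_zero, hvw] at h
      rw [map_sub, ← sub_sub_self (delta A n u) (cycInv (n + 1) (delta A n u)), h]
      abel
    · rw [map_sub, delta_delta, sub_zero]

end IsCentralDecomposition
end OffDiagonal

/-! ### Functoriality for homomorphisms that need not preserve the identity -/

section NonunitalFunctoriality
variable {A D : Type*} [NormedRing A] [NormedAlgebra ℂ A] [NormedRing D] [NormedAlgebra ℂ D]

/-- The map on cochains induced by a continuous linear map. -/
def linearPullback (κ : D →L[ℂ] A) (n : ℕ) : Cochain A n →L[ℂ] Cochain D n :=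
  ContinuousMultilinearMap.compContinuousLinearMapL (fun _ : Fin (n + 1) => κ)

theorem linearPullback_apply (κ : D →L[ℂ] A) (n : ℕ) (f : Cochain A n) (a : Fin (n + 1) → D) :
    linearPullback κ n f a = f (fun k => κ (a k)) := rfl

theorem linearPullback_mem_cyclicCochains (κ : D →L[ℂ] A) (n : ℕ) {f : Cochain A n}
    (hf : f ∈ cyclicCochains A n) : linearPullback κ n f ∈ cyclicCochains D n :=
  fun a => hf fun k => κ (a k)

theorem delta_linearPullback {κ : D →L[ℂ] A} (hκ : ∀ x y, κ (x * y) = κ x * κ y) (n : ℕ)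
    (f : Cochain A n) :
    delta D n (linearPullback κ n f) = linearPullback κ (n + 1) (delta A n f) := by
  ext a
  have h1 : ∀ i : Fin (n + 1), (fun k => κ (merge i a k)) = merge i (fun k => κ (a k)) := by
    intro i; ext k; simp only [merge]; split_ifs <;> simp [hκ]
  have h2 : (fun k => κ (mergeLast a k)) = mergeLast (fun k => κ (a k)) := by
    ext k; simp only [mergeLast]; split_ifs <;> simp [hκ]
  simp only [delta_apply, linearPullback_apply, h1, h2]

theorem linearPullback_mem_cyclicCocycles {κ : D →L[ℂ] A} (hκ : ∀ x y, κ (x * y) = κ x * κ y)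
    (n : ℕ) {f : Cochain A n} (hf : f ∈ cyclicCocycles A n) :
    linearPullback κ n f ∈ cyclicCocycles D n := by
  refine ⟨linearPullback_mem_cyclicCochains κ n hf.1, LinearMap.mem_ker.2 ?_⟩
  rw [delta_linearPullback hκ, LinearMap.mem_ker.1 hf.2, map_zero]

theorem linearPullback_mem_cyclicCoboundaries {κ : D →L[ℂ] A}
    (hκ : ∀ x y, κ (x * y) = κ x * κ y) (n : ℕ) {f : Cochain A n}
    (hf : f ∈ cyclicCoboundaries A n) : linearPullback κ n f ∈ cyclicCoboundaries D n := by
  cases n with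
  | zero =>
    obtain rfl : f = 0 := hf
    rw [map_zero]
    exact Submodule.zero_mem _
  | succ n =>
    obtain ⟨g, hg, rfl⟩ := hf
    exact ⟨_, linearPullback_mem_cyclicCochains κ n hg, delta_linearPullback hκ n g⟩

/-- The map `HC^n(A) → HC^n(D)` induced by a continuous multiplicative linear map `κ : D → A`,
which need not preserve the identity. -/
def nonunitalHCmap (κ : D →L[ℂ] A) (hκ : ∀ x y, κ (x * y) = κ x * κ y) (n : ℕ) :
    HC A n →ₗ[ℂ] HC D n :=
  Submodule.mapQ _ _ ((linearPullback κ n : Cochain A n →ₗ[ℂ] Cochain D n).restrict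
      fun _ hf => linearPullback_mem_cyclicCocycles hκ n hf)
    fun _ hf => linearPullback_mem_cyclicCoboundaries hκ n hf

theorem continuous_nonunitalHCmap (κ : D →L[ℂ] A) (hκ : ∀ x y, κ (x * y) = κ x * κ y) (n : ℕ) :
    Continuous (nonunitalHCmap κ hκ n) := by
  refine (Submodule.isQuotientMap_mkQ _).continuous_iff.2 ?_
  refine (Submodule.isQuotientMap_mkQ _).continuous.comp (Continuous.subtype_mk ?_ _)
  exact (linearPullback κ n).continuous.comp continuous_subtype_val

/-- `HCmap` agrees definitionally with `nonunitalHCmap` of the underlying linear map. -/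
theorem continuous_HCmap (κ : D →A[ℂ] A) (n : ℕ) : Continuous (HCmap κ n) :=
  continuous_nonunitalHCmap κ.toContinuousLinearMap (map_mul κ) n

end NonunitalFunctoriality

/-! ### Inclusions and projections of a direct sum -/

section DirectSum
variable {ι : Type*} [DecidableEq ι] {A : ι → Type*} [∀ i, NormedRing (A i)]
  [∀ i, NormedAlgebra ℂ (A i)] {D : Type*} [NormedRing D] [NormedAlgebra ℂ D]

/-- The inclusion of a direct factor, a homomorphism that need not preserve the identity. -/
def inclusion (φ : D ≃A[ℂ] (∀ i, A i)) (i : ι) : A i →L[ℂ] D :=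
  (φ.symm : (∀ i, A i) →A[ℂ] D).toContinuousLinearMap.comp (ContinuousLinearMap.single ℂ A i)

theorem inclusion_apply (φ : D ≃A[ℂ] (∀ i, A i)) (i : ι) (x : A i) :
    inclusion φ i x = φ.symm (Pi.single i x) := rfl

theorem inclusion_mul (φ : D ≃A[ℂ] (∀ i, A i)) (i : ι) (x y : A i) :
    inclusion φ i (x * y) = inclusion φ i x * inclusion φ i y := by
  simp only [inclusion_apply, Pi.single_mul, map_mul]

/-- The canonical projection onto a direct factor. -/
def factorProjection (φ : D ≃A[ℂ] (∀ i, A i)) (i : ι) : D →A[ℂ] A i :=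
  (projection A i).comp (φ : D →A[ℂ] (∀ i, A i))

theorem factorProjection_apply (φ : D ≃A[ℂ] (∀ i, A i)) (i : ι) (d : D) :
    factorProjection φ i d = φ d i := rfl

theorem inclusion_factorProjection (φ : D ≃A[ℂ] (∀ i, A i)) (i : ι) (d : D) :
    inclusion φ i (factorProjection φ i d) = φ.symm (Pi.single i 1) * d := by
  apply EquivLike.injective φ
  rw [inclusion_apply, factorProjection_apply, map_mul, φ.apply_symm_apply, φ.apply_symm_apply]
  ext j
  by_cases h : j = i
  · subst h; simp
  · simp [h]

theorem isCentralDecomposition_single [Fintype ι] (φ : D ≃A[ℂ] (∀ i, A i)) :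
    IsCentralDecomposition fun i => φ.symm (Pi.single i 1) where
  central i x := by
    apply EquivLike.injective φ
    rw [map_mul, map_mul, φ.apply_symm_apply]
    ext j
    by_cases h : j = i
    · subst h; simp
    · simp [h]
  idem i := by rw [← map_mul, ← Pi.single_mul, one_mul]
  orthogonal i j h := by
    rw [← map_mul, ← map_zero φ.symm]
    congr 1
    ext k
    by_cases hk : k = i
    · subst hk; simp [h]
    · simp [hk]
  sum_eq_one := by
    rw [← map_sum, ← map_one φ.symm]
    congr 1
    exact Finset.univ_sum_single (1 : ∀ i, A i)

theorem linearPullback_inclusion_pullback (φ : D ≃A[ℂ] (∀ i, A i)) (n : ℕ) (i j : ι)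
    (f : Cochain (A j) n) :
    linearPullback (inclusion φ i) n (pullback (factorProjection φ j) n f) =
      if h : j = i then h ▸ f else 0 := by
  ext a
  rw [linearPullback_apply, pullback_apply]
  simp only [factorProjection_apply, inclusion_apply, φ.apply_symm_apply]
  split_ifs with h
  · subst h; simp
  · exact f.map_coord_zero 0 (by simp [h])

theorem nonunitalHCmap_inclusion_sum [Fintype ι] (φ : D ≃A[ℂ] (∀ i, A i)) (n : ℕ) (i : ι)
    (x : ∀ i, HC (A i) n) :
    nonunitalHCmap (inclusion φ i) (inclusion_mul φ i) n
      (∑ j, HCmap (factorProjection φ j) n (x j)) = x i := by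
  have h : ∀ j, nonunitalHCmap (inclusion φ i) (inclusion_mul φ i) n
      (HCmap (factorProjection φ j) n (x j)) = if j = i then x i else 0 := by
    intro j
    obtain ⟨f, hf⟩ := Submodule.Quotient.mk_surjective _ (x j)
    rw [← hf]
    have H := linearPullback_inclusion_pullback φ n i j (f : Cochain (A j) n)
    split_ifs with h
    · subst h
      rw [← hf]
      exact congrArg Submodule.Quotient.mk (Subtype.ext (by simpa using H))
    · rw [dif_neg h] at H
      exact (congrArg Submodule.Quotient.mk (Subtype.ext H)).trans (Submodule.Quotient.mk_zero _)
  simp [map_sum, h]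

theorem sum_HCmap_nonunitalHCmap [Fintype ι] (φ : D ≃A[ℂ] (∀ i, A i)) (n : ℕ) (y : HC D n) :
    ∑ i, HCmap (factorProjection φ i) n
      (nonunitalHCmap (inclusion φ i) (inclusion_mul φ i) n y) = y := by
  obtain ⟨f, rfl⟩ := Submodule.Quotient.mk_surjective _ y
  have he := isCentralDecomposition_single φ
  let g : ι → cyclicCocycles D n := fun i =>
    ⟨_, pullback_mem_cyclicCocycles (factorProjection φ i) n
    (linearPullback_mem_cyclicCocycles (inclusion_mul φ i) n f.2)⟩
  have hg : ∀ i a, (g i : Cochain D n) a =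
      (f : Cochain D n) fun k => φ.symm (Pi.single i 1) * a k := by
    intro i a
    simp only [← inclusion_factorProjection]
    rfl
  change ∑ i, Submodule.mkQ _ (g i) = Submodule.mkQ _ f
  rw [← map_sum, ← sub_eq_zero, ← map_sub, Submodule.mkQ_apply, Submodule.Quotient.mk_eq_zero]
  -- On (e_i D)^{n+1} the i-th summand reproduces f because e_i is idempotent; every other summand
  -- has an argument containing e_j e_i = 0.
  refine he.mem_cyclicCoboundaries n (∑ i, g i - f).2 fun i a => ?_
  change ((∑ i, g i - f : cyclicCocycles D n) : Cochain D n) _ = 0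
  rw [Submodule.coe_sub, Submodule.coe_sum, Cochain.sub_apply, Cochain.sum_apply, sub_eq_zero,
    Finset.sum_eq_single i]
  · simp only [hg, ← mul_assoc, he.idem]
  · intro j _ hj
    rw [hg]
    exact (f : Cochain D n).map_coord_zero 0 (by rw [← mul_assoc, he.orthogonal j i hj, zero_mul])
  · exact fun h => absurd (Finset.mem_univ i) h

end DirectSum

end BanachCyclic

end

/-- `D` is the Banach algebra direct sum of the `A i`: the algebra `∏ i, A i` with any
submultiplicative complete norm inducing the product topology. -/
theorem proposition4p4 (m : ℕ) (A : Fin m → Type*)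
    [∀ i, NormedRing (A i)] [∀ i, NormedAlgebra ℂ (A i)] [∀ i, CompleteSpace (A i)]
    (D : Type*) [NormedRing D] [NormedAlgebra ℂ D] [CompleteSpace D]
    (φ : D ≃A[ℂ] (∀ i, A i)) (n : ℕ) :
    ∃ e : (∀ i, BanachCyclic.HC (A i) n) ≃L[ℂ] BanachCyclic.HC D n,
      ∀ x : ∀ i, BanachCyclic.HC (A i) n,
        e x = ∑ i, BanachCyclic.HCmap
          ((BanachCyclic.projection A i).comp (φ : D →A[ℂ] (∀ i, A i))) n (x i) := by
  let F : (∀ i, BanachCyclic.HC (A i) n) →ₗ[ℂ] BanachCyclic.HC D n :=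
    ∑ i, BanachCyclic.HCmap (BanachCyclic.factorProjection φ i) n ∘ₗ LinearMap.proj i
  have hF : ∀ x, F x = ∑ i, BanachCyclic.HCmap (BanachCyclic.factorProjection φ i) n (x i) :=
    fun x => by simp [F, LinearMap.sum_apply]
  let G : BanachCyclic.HC D n →ₗ[ℂ] (∀ i, BanachCyclic.HC (A i) n) :=
    LinearMap.pi fun i => BanachCyclic.nonunitalHCmap (BanachCyclic.inclusion φ i)
      (BanachCyclic.inclusion_mul φ i) n
  have hGF : ∀ x, G (F x) = x := fun x => funext fun i => by
    rw [hF]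
    exact BanachCyclic.nonunitalHCmap_inclusion_sum φ n i x
  have hFG : ∀ y, F (G y) = y := fun y => by
    rw [hF]
    exact BanachCyclic.sum_HCmap_nonunitalHCmap φ n y
  -- Continuity is checked in both directions, so no open mapping theorem is needed.
  refine ⟨{ toLinearEquiv := LinearEquiv.ofLinearMap F G (LinearMap.ext hFG) (LinearMap.ext hGF)
            continuous_toFun := ?_
            continuous_invFun := ?_ }, hF⟩
  · refine (continuous_finsetSum _ fun i _ => ?_ :
      Continuous fun x : ∀ i, BanachCyclic.HC (A i) n =>
        ∑ i, BanachCyclic.HCmap (BanachCyclic.factorProjection φ i) n (x i)).congr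
          fun x => (hF x).symm
    exact (BanachCyclic.continuous_HCmap _ n).comp (continuous_apply i)
  · exact continuous_pi fun i => BanachCyclic.continuous_nonunitalHCmap _
      (BanachCyclic.inclusion_mul φ i) n
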